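/- Conventions. A function $u:D\to[-\infty,+\infty)$ on an open set $D\subset\mathbb C^n$ is plurisubharmonic if it is upper semicontinuous and its restriction to every complex line is subharmonic. An open set $D\subset\mathbb C^n$ (not necessarily connected) is pseudoconvex if there is a continuous plurisubharmonic function $\varphi:D\to\mathbb R$ such that $\{z\in D:\varphi(z)<c\}$ is relatively compact in $D$ for every $c\in\mathbb R$. $B(\zeta,r)$ denotes the open Euclidean ball. Proposition 2.3. Let $\Omega$ be a bounded domain in $\mathbb C^n$ and let $F\subset\partial\Omega$ be a non-empty closed set with the following properties: (1) $\partial\Omega\setminus F$ is locally pseudoconvex, i.e. for every $\zeta\in\partial\Omega\setminus F$ there exists $r>0$ such that $B(\zeta,r)\cap\Omega$ is pseudoconvex; (2) there exist a pseudoconvex open neighbourhood $U$ of $F$ in $\mathbb C^n$ and a continuous plurisubharmonic function $v$ on $U\cap\Omega$ (continuous as a function into $[-\infty,+\infty)$) such that $$F=\Big\{z\in\partial\Omega\cap\overline{U\cap\Omega}:\ \lim_{\xi\to z,\ \xi\in U\cap\Omega}v(\xi)=+\infty\Big\}.$$ Then $\Omega$ is pseudoconvex. -/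

import Mathlib

open Set Filter Topology

/-- A function `f` with values in `[-∞, +∞)` is subharmonic on the open set `s ⊆ ℂ`: it is upper
semicontinuous and satisfies the local submean inequality, `f c` being at most the mean of `f` over
every sufficiently small circle about `c`. Since `f` is bounded above on circles but may be
unbounded below, the mean in `[-∞, +∞)` is the decreasing limit, as `M → -∞`, of the means of the
bounded functions `max f M`; the inequality is therefore required against each of these. -/
structure SubharmonicOn (f : ℂ → EReal) (s : Set ℂ) : Prop where
  lt_top : ∀ z ∈ s, f z < ⊤
  usc : UpperSemicontinuousOn f s
  submean : ∀ c ∈ s, ∀ᶠ r in 𝓝[>] (0 : ℝ), ∀ M : ℝ,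
    f c ≤ ((Real.circleAverage (fun z => (max (f z) (M : EReal)).toReal) c r : ℝ) : EReal)

/-- A function `u` with values in `[-∞, +∞)` is plurisubharmonic on the open set `s`: it is upper
semicontinuous, and its restriction to every complex line is subharmonic. -/
structure PlurisubharmonicOn {n : ℕ} (u : EuclideanSpace ℂ (Fin n) → EReal)
    (s : Set (EuclideanSpace ℂ (Fin n))) : Prop where
  lt_top : ∀ z ∈ s, u z < ⊤
  usc : UpperSemicontinuousOn u s
  subharmonicOn_line : ∀ a b : EuclideanSpace ℂ (Fin n),
    SubharmonicOn (fun τ : ℂ => u (a + τ • b)) {τ : ℂ | a + τ • b ∈ s}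

/-- An open set (not necessarily connected) of `ℂⁿ` is pseudoconvex if it carries a continuous
plurisubharmonic exhaustion function: all sublevel sets are relatively compact in it. -/
def IsPseudoconvex {n : ℕ} (D : Set (EuclideanSpace ℂ (Fin n))) : Prop :=
  IsOpen D ∧ ∃ φ : EuclideanSpace ℂ (Fin n) → ℝ,
    ContinuousOn φ D ∧ PlurisubharmonicOn (fun z => (φ z : EReal)) D ∧
    ∀ c : ℝ, ∃ K : Set (EuclideanSpace ℂ (Fin n)), IsCompact K ∧ K ⊆ D ∧ {z ∈ D | φ z < c} ⊆ K

/-- The part `A` of the boundary of `D` is locally pseudoconvex: each of its points is the centre of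
a ball whose intersection with `D` is pseudoconvex. -/
def IsLocallyPseudoconvexAlong {n : ℕ} (D A : Set (EuclideanSpace ℂ (Fin n))) : Prop :=
  ∀ ζ ∈ A, ∃ r : ℝ, 0 < r ∧ IsPseudoconvex (Metric.ball ζ r ∩ D)

/-!
For bounded open sets, a continuous plurisubharmonic exhaustion exists if and only if the
continuity principle holds, and for the latter it suffices to check it near every boundary point.

One direction is the maximum principle on discs. As submean inequalities are only given on lines,
a function `φ` violating it along a curved disc `g` is handled by maximizing
`φ (g τ + w) + η ‖τ‖ ^ 2 - κ ‖w‖ ^ 2`: at an interior maximum `(τ₀, w₀)` one can move along the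
disc while `w` compensates for its curvature, so that the argument of `φ` stays on a line.
Conversely, let `δ` be the distance to the complement. If `-log δ < Re f` on the boundary of a disc
`g`, with `f` entire, the continuity principle for the discs `g + t exp (-f) a` shows that
`-log δ ≤ Re f` inside; since real parts of entire functions are dense in the continuous functions
on a circle, `-log δ` satisfies the submean inequality. This argument is local near the boundary,
and replacing `-log δ` by its maximum with a constant takes care of the rest.

At the points of `F`, local control comes from `U ∩ Ω`: it is exhausted by the sublevel sets of `v`,
whose closures avoid `F`, so each of them is governed by the hypotheses on `U`, `v` and
`∂Ω \ F`.
-/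

section Submean

variable {E : Type*} [NormedAddCommGroup E] [NormedSpace ℂ E] {φ ψ : E → ℝ} {s t : Set E} {z : E}

/-- The local submean inequality at the point `z`, on small circles in every complex line
through `z`. -/
def SubmeanAt (φ : E → ℝ) (z : E) : Prop :=
  ∀ b : E, ∀ᶠ r in 𝓝[>] (0 : ℝ), φ z ≤ Real.circleAverage (fun τ : ℂ => φ (z + τ • b)) 0 r

/-- Continuous real-valued plurisubharmonic functions on an open set in a complex normed space. -/
structure ContinuousPSHOn (φ : E → ℝ) (s : Set E) : Prop where
  continuousOn : ContinuousOn φ s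
  submeanAt : ∀ z ∈ s, SubmeanAt φ z

theorem eventually_mapsTo_line (hs : s ∈ 𝓝 z) (b : E) :
    ∀ᶠ r in 𝓝[>] (0 : ℝ), MapsTo (fun τ : ℂ => z + τ • b) (Metric.closedBall 0 r) s := by
  have hline : Tendsto (fun τ : ℂ => z + τ • b) (𝓝 0) (𝓝 z) := by
    simpa using (by fun_prop : Continuous fun τ : ℂ => z + τ • b).tendsto 0
  exact (eventually_closedBall_subset (hline hs)).filter_mono nhdsWithin_le_nhds

theorem eventually_continuousOn_sphere_line (hs : s ∈ 𝓝 z) (hφ : ContinuousOn φ s) (b : E) :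
    ∀ᶠ r in 𝓝[>] (0 : ℝ), ContinuousOn (fun τ : ℂ => φ (z + τ • b)) (Metric.sphere 0 r) :=
  (eventually_mapsTo_line hs b).mono fun _ hmaps =>
    hφ.comp (by fun_prop) (hmaps.mono_left Metric.sphere_subset_closedBall)

theorem SubmeanAt.of_le (h : SubmeanAt φ z) (hs : s ∈ 𝓝 z) (hφ : ContinuousOn φ s)
    (hψ : ContinuousOn ψ s) (hle : ∀ w ∈ s, φ w ≤ ψ w) (hz : ψ z ≤ φ z) : SubmeanAt ψ z := by
  intro b
  filter_upwards [h b, eventually_continuousOn_sphere_line hs hφ b,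
    eventually_continuousOn_sphere_line hs hψ b, eventually_mapsTo_line hs b, self_mem_nhdsWithin]
    with r hmean hφr hψr hmaps hr
  have hr : 0 < r := hr
  refine (hz.trans hmean).trans (Real.circleAverage_mono (hφr.circleIntegrable hr.le)
    (hψr.circleIntegrable hr.le) fun τ hτ => hle _ (hmaps ?_))
  rw [abs_of_pos hr] at hτ
  exact Metric.sphere_subset_closedBall hτ

theorem submeanAt_const (C : ℝ) (z : E) : SubmeanAt (fun _ => C) z := fun _ => by
  simp only [Real.circleAverage_const, le_refl, eventually_true]

theorem submeanAt_max_const (hs : s ∈ 𝓝 z) (hφ : ContinuousOn φ s) {C : ℝ}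
    (h : C < φ z → SubmeanAt φ z) : SubmeanAt (fun w => max (φ w) C) z := by
  have hmax : ContinuousOn (fun w => max (φ w) C) s := hφ.sup continuousOn_const
  rcases lt_or_ge C (φ z) with hlt | hle
  · exact (h hlt).of_le hs hφ hmax (fun _ _ => le_max_left _ _) (max_le le_rfl hlt.le)
  · exact (submeanAt_const C z).of_le hs continuousOn_const hmax (fun _ _ => le_max_right _ _)
      (max_le hle le_rfl)

theorem ContinuousPSHOn.mono (h : ContinuousPSHOn φ t) (hst : s ⊆ t) : ContinuousPSHOn φ s :=
  ⟨h.continuousOn.mono hst, fun z hz => h.submeanAt z (hst hz)⟩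

theorem exists_continuousPSHOn_max_const [ProperSpace E] (hs : IsOpen s)
    (hb : Bornology.IsBounded s) (hφ : ContinuousOn φ s)
    (hsub : ∀ ζ ∈ frontier s, ∀ᶠ z in 𝓝[s] ζ, SubmeanAt φ z) :
    ∃ C : ℝ, ContinuousPSHOn (fun z => max (φ z) C) s := by
  set W : Set E := interior {z | z ∈ s → SubmeanAt φ z}
  have hWfrontier : frontier s ⊆ W := fun ζ hζ =>
    mem_interior_iff_mem_nhds.2 (eventually_nhdsWithin_iff.1 (hsub ζ hζ))
  have hcompl : s \ W = closure s \ W := by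
    rw [closure_eq_self_union_frontier, union_sdiff_distrib, sdiff_eq_empty.2 hWfrontier,
      union_empty]
  have hcompact : IsCompact (s \ W) := hcompl ▸ hb.isCompact_closure.diff isOpen_interior
  obtain ⟨C, hC⟩ := hcompact.bddAbove_image (hφ.mono sdiff_subset)
  refine ⟨C, hφ.sup continuousOn_const, fun z hz =>
    submeanAt_max_const (hs.mem_nhds hz) hφ fun hlt => ?_⟩
  have hzW : z ∈ W := by
    by_contra hzW
    exact hlt.not_ge (hC (mem_image_of_mem φ ⟨hz, hzW⟩))
  exact interior_subset hzW hz

end Submean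

section EntireFunctions

theorem circleAverage_re_of_differentiable {f : ℂ → ℂ} (hf : Differentiable ℂ f) (c : ℂ) (r : ℝ) :
    Real.circleAverage (fun τ => (f τ).re) c r = (f c).re :=
  InnerProductSpace.HarmonicOnNhd.circleAverage_eq fun τ _ => (hf.analyticAt τ).harmonicAt_re

/-- The constant `a` makes the claim stable under complex scalar multiples of `P`. -/
theorem exists_entire_re_mul_eq_of_mem_span_fourier {P : C(AddCircle (2 * Real.pi), ℂ)}
    (hP : P ∈ Submodule.span ℂ (range <| @fourier (2 * Real.pi))) (a : ℂ) :
    ∃ f : ℂ → ℂ, Differentiable ℂ f ∧ ∀ x, (a * P x).re = (f (AddCircle.toCircle x)).re := by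
  induction hP using Submodule.span_induction generalizing a with
  | mem P hP =>
    obtain ⟨n, rfl⟩ := hP
    obtain ⟨k, rfl | rfl⟩ := n.eq_nat_or_neg
    · refine ⟨fun τ => a * τ ^ k, by fun_prop, fun x => ?_⟩
      simp [fourier_apply, AddCircle.toCircle_nsmul]
    · -- `Re (a * conj (τ ^ k)) = Re (conj a * τ ^ k)`
      refine ⟨fun τ => starRingEnd ℂ a * τ ^ k, by fun_prop, fun x => ?_⟩
      rw [fourier_neg, ← Complex.conj_re]
      simp [fourier_apply, AddCircle.toCircle_nsmul]
  | zero => exact ⟨0, by fun_prop, by simp⟩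
  | add P Q _ _ ihP ihQ =>
    obtain ⟨f, hf, hfP⟩ := ihP a
    obtain ⟨g, hg, hgQ⟩ := ihQ a
    exact ⟨f + g, hf.add hg, fun x => by simp [mul_add, hfP, hgQ, -Complex.mul_re]⟩
  | smul c P _ ih =>
    obtain ⟨f, hf, hfP⟩ := ih (a * c)
    exact ⟨f, hf, fun x => by simp [← hfP, mul_assoc, -Complex.mul_re]⟩

theorem exists_entire_re_near_on_circle {u : Circle → ℝ} (hu : Continuous u) {ε : ℝ} (hε : 0 < ε) :
    ∃ f : ℂ → ℂ, Differentiable ℂ f ∧ ∀ τ : Circle, |u τ - (f τ).re| < ε := by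
  have : Fact (0 < 2 * Real.pi) := ⟨Real.two_pi_pos⟩
  let U : C(AddCircle (2 * Real.pi), ℂ) :=
    ⟨fun x => u (AddCircle.toCircle x),
      Complex.continuous_ofReal.comp (hu.comp AddCircle.continuous_toCircle)⟩
  have hU : U ∈ (Submodule.span ℂ (range <| @fourier (2 * Real.pi))).topologicalClosure := by
    rw [span_fourier_closure_eq_top]
    exact Submodule.mem_top
  obtain ⟨P, hP, hUP⟩ := Metric.mem_closure_iff.1 hU ε hε
  obtain ⟨f, hf, hPf⟩ := exists_entire_re_mul_eq_of_mem_span_fourier hP 1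
  refine ⟨f, hf, fun τ => ?_⟩
  obtain ⟨x, rfl⟩ := (AddCircle.homeomorphCircle Real.two_pi_pos.ne').surjective τ
  rw [AddCircle.homeomorphCircle_apply]
  calc |u (AddCircle.toCircle x) - (f (AddCircle.toCircle x)).re| = |(U x - P x).re| := by
        rw [← hPf, one_mul, Complex.sub_re]
        rfl
    _ ≤ dist (U x) (P x) := by
        rw [dist_eq_norm]
        exact Complex.abs_re_le_norm _
    _ < ε := (ContinuousMap.dist_apply_le_dist x).trans_lt hUP

theorem exists_entire_re_near_on_sphere {u : ℂ → ℝ} {r : ℝ} (hr : 0 < r)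
    (hu : ContinuousOn u (Metric.sphere 0 r)) {ε : ℝ} (hε : 0 < ε) :
    ∃ f : ℂ → ℂ, Differentiable ℂ f ∧ ∀ τ ∈ Metric.sphere (0 : ℂ) r, |u τ - (f τ).re| < ε := by
  have hscaled : Continuous fun τ : Circle => u (r * τ) :=
    hu.comp_continuous (by fun_prop) fun τ => by simp [abs_of_pos hr, Circle.norm_coe]
  obtain ⟨f, hf, hfu⟩ := exists_entire_re_near_on_circle hscaled hε
  refine ⟨fun τ => f (τ / r), by fun_prop, fun τ hτ => ?_⟩
  have hunit : τ / r ∈ Submonoid.unitSphere ℂ := by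
    simp [Submonoid.unitSphere, mem_sphere_zero_iff_norm.1 hτ, abs_of_pos hr, hr.ne']
  have hr' : (r : ℂ) ≠ 0 := mod_cast hr.ne'
  simpa [mul_div_cancel₀ _ hr'] using hfu ⟨τ / r, hunit⟩

theorem le_circleAverage_of_forall_entire {u : ℂ → ℝ} {r A : ℝ} (hr : 0 < r)
    (hu : ContinuousOn u (Metric.sphere 0 r))
    (hA : ∀ f : ℂ → ℂ, Differentiable ℂ f → (∀ τ ∈ Metric.sphere 0 r, u τ < (f τ).re) →
      A ≤ (f 0).re) :
    A ≤ Real.circleAverage u 0 r := by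
  refine le_of_forall_pos_le_add fun ε hε => ?_
  have hshift : ContinuousOn (fun τ => u τ + ε / 2) (Metric.sphere 0 r) :=
    hu.add continuousOn_const
  obtain ⟨f, hf, hfu⟩ := exists_entire_re_near_on_sphere hr hshift (half_pos hε)
  have hui : CircleIntegrable u 0 r := hu.circleIntegrable hr.le
  calc A ≤ (f 0).re := hA f hf fun τ hτ => by linarith [(abs_lt.1 (hfu τ hτ)).2]
    _ = Real.circleAverage (fun τ => (f τ).re) 0 r :=
        (circleAverage_re_of_differentiable hf 0 r).symm
    _ ≤ Real.circleAverage (fun τ => u τ + ε) 0 r := by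
        refine Real.circleAverage_mono
          (Complex.continuous_re.comp hf.continuous).continuousOn.circleIntegrable'
          (hui.add (circleIntegrable_const _ _ _)) fun τ hτ => ?_
        rw [abs_of_pos hr] at hτ
        linarith [(abs_lt.1 (hfu τ hτ)).1]
    _ = Real.circleAverage u 0 r + ε := by
        rw [Real.circleAverage_fun_add hui (circleIntegrable_const _ _ _),
          Real.circleAverage_const]

end EntireFunctions

section MaximumPrinciple

theorem SubmeanAt.nonpos_of_eventually_le {E : Type*} [NormedAddCommGroup E] [NormedSpace ℂ E]
    {φ : E → ℝ} {s : Set E} {z b : E} (h : SubmeanAt φ z) (hs : s ∈ 𝓝 z) (hφ : ContinuousOn φ s)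
    {f : ℂ → ℂ} (hf : Differentiable ℂ f) (hf0 : f 0 = 0) {c : ℝ}
    (hle : ∀ᶠ σ in 𝓝 (0 : ℂ), φ (z + σ • b) ≤ φ z + (f σ).re - c * ‖σ‖ ^ 2) : c ≤ 0 := by
  obtain ⟨r, hmean, hφr, hball, hr⟩ := ((h b).and
    ((eventually_continuousOn_sphere_line hs hφ b).and
      (((eventually_closedBall_subset hle).filter_mono nhdsWithin_le_nhds).and
        self_mem_nhdsWithin))).exists
  have hr : 0 < r := hr
  have hfi : CircleIntegrable (fun σ => (f σ).re) 0 r :=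
    (Complex.continuous_re.comp hf.continuous).continuousOn.circleIntegrable'
  have hconst : CircleIntegrable (fun _ => φ z - c * r ^ 2) 0 r := circleIntegrable_const _ _ _
  have hchain : φ z ≤ φ z - c * r ^ 2 :=
    calc φ z ≤ Real.circleAverage (fun σ => φ (z + σ • b)) 0 r := hmean
      _ ≤ Real.circleAverage (fun σ => φ z - c * r ^ 2 + (f σ).re) 0 r := by
          refine Real.circleAverage_mono (hφr.circleIntegrable hr.le) (hconst.add hfi)
            fun σ hσ => ?_
          rw [abs_of_pos hr] at hσ
          have := hball (Metric.sphere_subset_closedBall hσ)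
          rw [mem_ofPred_eq, mem_sphere_zero_iff_norm.1 hσ] at this
          linarith
      _ = φ z - c * r ^ 2 := by
          rw [Real.circleAverage_fun_add hconst hfi, circleAverage_re_of_differentiable hf, hf0,
            Real.circleAverage_const, Complex.zero_re, add_zero]
  have : 0 < r ^ 2 := by positivity
  nlinarith

section Penalty

variable {E : Type*} [NormedAddCommGroup E] {φ : E → ℝ} {s : Set E} {g : ℂ → E}

theorem exists_tube_lt {R m : ℝ} (hs : IsOpen s) (hφ : ContinuousOn φ s) (hg : Continuous g)
    (hgs : MapsTo g (Metric.closedBall 0 R) s) (hm : ∀ τ ∈ Metric.sphere 0 R, φ (g τ) < m) :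
    ∃ ρ > 0, ∀ w ∈ Metric.closedBall (0 : E) ρ, (∀ τ ∈ Metric.closedBall 0 R, g τ + w ∈ s) ∧
      ∀ τ ∈ Metric.sphere 0 R, φ (g τ + w) < m := by
  have hadd : ∀ τ, Tendsto (fun p : E × ℂ => g p.2 + p.1) (𝓝 (0, τ)) (𝓝 (g τ)) := fun τ => by
    simpa using (by fun_prop : Continuous fun p : E × ℂ => g p.2 + p.1).tendsto (0, τ)
  have hmem : ∀ᶠ w in 𝓝 (0 : E), ∀ τ ∈ Metric.closedBall 0 R, g τ + w ∈ s :=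
    (isCompact_closedBall _ _).eventually_forall_of_forall_eventually fun τ hτ =>
      (hadd τ).eventually (hs.mem_nhds (hgs hτ))
  have hlt : ∀ᶠ w in 𝓝 (0 : E), ∀ τ ∈ Metric.sphere 0 R, φ (g τ + w) < m := by
    refine (isCompact_sphere _ _).eventually_forall_of_forall_eventually fun τ hτ => ?_
    have hφτ := hφ.continuousAt (hs.mem_nhds (hgs (Metric.sphere_subset_closedBall hτ)))
    exact (hφτ.tendsto.comp (hadd τ)).eventually_lt_const (hm τ hτ)
  obtain ⟨ρ, hρ, h⟩ := Metric.nhds_basis_closedBall.mem_iff.1 (hmem.and hlt)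
  exact ⟨ρ, hρ, fun w hw => h hw⟩

/-- The function `φ` near the disc `g`, at the point displaced by `w` from `g τ`, where
`p = (τ, w)`: the first correction makes it strictly subharmonic along the disc, the second
penalizes the displacement. -/
noncomputable def penalizedDisc (φ : E → ℝ) (g : ℂ → E) (η κ : ℝ) (p : ℂ × E) : ℝ :=
  φ (g p.1 + p.2) + η * ‖p.1‖ ^ 2 - κ * ‖p.2‖ ^ 2

theorem penalizedDisc_lt_of_notMem_ball_prod {R ρ η κ m M : ℝ} (hη : 0 ≤ η) (hκ : 0 ≤ κ)
    (hM : ∀ p ∈ Metric.closedBall (0 : ℂ) R ×ˢ Metric.closedBall (0 : E) ρ, φ (g p.1 + p.2) ≤ M)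
    (hMm : M + η * R ^ 2 - κ * ρ ^ 2 < m)
    (hside : ∀ w ∈ Metric.closedBall (0 : E) ρ, ∀ τ ∈ Metric.sphere 0 R,
      φ (g τ + w) < m - η * R ^ 2)
    {p : ℂ × E} (hp : p ∈ Metric.closedBall (0 : ℂ) R ×ˢ Metric.closedBall (0 : E) ρ)
    (hp' : p ∉ Metric.ball (0 : ℂ) R ×ˢ Metric.ball (0 : E) ρ) : penalizedDisc φ g η κ p < m := by
  obtain ⟨τ, w⟩ := p
  obtain ⟨hτ, hw⟩ := hp
  have hφM : φ (g τ + w) ≤ M := hM (τ, w) ⟨hτ, hw⟩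
  have hητ : η * ‖τ‖ ^ 2 ≤ η * R ^ 2 := by gcongr; exact mem_closedBall_zero_iff.1 hτ
  have hκw : 0 ≤ κ * ‖w‖ ^ 2 := by positivity
  simp only [penalizedDisc]
  rcases (mem_closedBall_zero_iff.1 hτ).lt_or_eq with hτR | hτR
  · have hwρ : ‖w‖ = ρ := (mem_closedBall_zero_iff.1 hw).eq_of_not_lt fun hwρ =>
      hp' ⟨mem_ball_zero_iff.2 hτR, mem_ball_zero_iff.2 hwρ⟩
    rw [← hwρ] at hMm
    linarith
  · have := hside w hw τ (mem_sphere_zero_iff_norm.2 hτR)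
    linarith

end Penalty

variable {E : Type*} [NormedAddCommGroup E] [InnerProductSpace ℂ E] {φ : E → ℝ} {s : Set E}
  {g : ℂ → E}

theorem not_isLocalMax_penalizedDisc {τ₀ : ℂ} {w₀ : E} (hφ : SubmeanAt φ (g τ₀ + w₀))
    (hs : s ∈ 𝓝 (g τ₀ + w₀)) (hφc : ContinuousOn φ s) (hg : Differentiable ℂ g) {η : ℝ}
    (hη : 0 < η) (κ : ℝ) : ¬ IsLocalMax (penalizedDisc φ g η κ) (τ₀, w₀) := by
  intro hmax
  set b := deriv g τ₀
  -- Along `(τ₀ + σ, w₀ - R σ)` the argument of `φ` moves on the complex line with direction `b`.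
  set R : ℂ → E := fun σ => g (τ₀ + σ) - g τ₀ - σ • b with hR
  have hRd : Differentiable ℂ R := by fun_prop
  have hR0 : R 0 = 0 := by simp [hR]
  have hRo : ∀ᶠ σ in 𝓝 (0 : ℂ), κ * ‖R σ‖ ^ 2 ≤ η / 2 * ‖σ‖ ^ 2 := by
    have hlittle := hasDerivAt_iff_isLittleO_nhds_zero.1 (hg τ₀).hasDerivAt
    filter_upwards [((hlittle.norm_norm.pow two_pos).const_mul_left κ).def (half_pos hη)] with σ hσ
    simpa using (le_abs_self _).trans hσ
  set f : ℂ → ℂ := fun σ => -(2 * η : ℝ) * inner ℂ τ₀ σ - (2 * κ : ℝ) * inner ℂ w₀ (R σ) with hf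
  have hfd : Differentiable ℂ f := by
    have h₁ : Differentiable ℂ fun σ => inner ℂ τ₀ σ := (innerSL ℂ τ₀).differentiable
    have h₂ : Differentiable ℂ fun σ => inner ℂ w₀ (R σ) := (innerSL ℂ w₀).differentiable.comp hRd
    fun_prop
  have hpath : Tendsto (fun σ => (τ₀ + σ, w₀ - R σ)) (𝓝 0) (𝓝 (τ₀, w₀)) := by
    have : Continuous fun σ => (τ₀ + σ, w₀ - R σ) := by
      have := hRd.continuous
      fun_prop
    simpa [hR0] using this.tendsto 0
  refine (half_pos hη).not_ge
    (hφ.nonpos_of_eventually_le (b := b) hs hφc hfd (by simp [hf, hR0]) ?_)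
  filter_upwards [hpath.eventually hmax, hRo] with σ hσ hRσ
  have hpoint : g (τ₀ + σ) + (w₀ - R σ) = g τ₀ + w₀ + σ • b := by
    simp only [hR]
    abel
  have hre : (f σ).re = -(2 * η) * (inner ℂ τ₀ σ).re - 2 * κ * (inner ℂ w₀ (R σ)).re := by
    simp only [hf, Complex.sub_re, neg_mul, Complex.neg_re, Complex.re_ofReal_mul]
  simp only [penalizedDisc, hpoint, norm_add_sq (𝕜 := ℂ) τ₀, norm_sub_sq (𝕜 := ℂ) w₀,
    RCLike.re_eq_complex_re] at hσ
  rw [hre]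
  linarith

theorem ContinuousPSHOn.le_of_forall_sphere_le [ProperSpace E] (hφ : ContinuousPSHOn φ s)
    (hs : IsOpen s) (hg : Differentiable ℂ g) {R m : ℝ} (hR : 0 < R)
    (hgs : MapsTo g (Metric.closedBall 0 R) s) (hm : ∀ τ ∈ Metric.sphere 0 R, φ (g τ) ≤ m)
    {τ : ℂ} (hτ : τ ∈ Metric.closedBall 0 R) : φ (g τ) ≤ m := by
  by_contra! hlt
  set A := φ (g τ)
  have hgc := hg.continuous
  obtain ⟨ρ, hρ, htube⟩ := exists_tube_lt hs hφ.continuousOn hgc hgs (m := (m + A) / 2)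
    fun σ hσ => (hm σ hσ).trans_lt (by linarith)
  set B := Metric.closedBall (0 : ℂ) R ×ˢ Metric.closedBall (0 : E) ρ
  have hB : IsCompact B := (isCompact_closedBall _ _).prod (isCompact_closedBall _ _)
  have hφB : ContinuousOn (fun p : ℂ × E => φ (g p.1 + p.2)) B :=
    hφ.continuousOn.comp (by fun_prop) fun p hp => (htube p.2 hp.2).1 p.1 hp.1
  obtain ⟨M, hM⟩ := hB.bddAbove_image hφB
  obtain ⟨η, hη, hηR⟩ : ∃ η > 0, η * R ^ 2 = (A - m) / 2 :=
    ⟨(A - m) / 2 / R ^ 2, by have := sub_pos.2 hlt; positivity, by field_simp⟩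
  obtain ⟨κ, hκ, hκρ⟩ : ∃ κ > 0, M + η * R ^ 2 - κ * ρ ^ 2 < A :=
    ⟨(|M + η * R ^ 2 - A| + 1) / ρ ^ 2, by positivity, by
      rw [div_mul_cancel₀ _ (by positivity)]
      linarith [le_abs_self (M + η * R ^ 2 - A)]⟩
  have hcenter : A ≤ penalizedDisc φ g η κ (τ, 0) := by
    have hητ : 0 ≤ η * ‖τ‖ ^ 2 := by positivity
    simpa [penalizedDisc, A] using hητ
  have hedge : ∀ p ∈ B \ Metric.ball 0 R ×ˢ Metric.ball 0 ρ,
      penalizedDisc φ g η κ p < penalizedDisc φ g η κ (τ, 0) := fun p hp =>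
    (penalizedDisc_lt_of_notMem_ball_prod hη.le hκ.le (fun q hq => hM (mem_image_of_mem _ hq)) hκρ
      (fun w hw σ hσ => ((htube w hw).2 σ hσ).trans_eq (by linarith)) hp.1 hp.2).trans_le hcenter
  obtain ⟨⟨τ₀, w₀⟩, hmem, hmax⟩ := hB.exists_isLocalMax_mem_open
    (prod_mono Metric.ball_subset_closedBall Metric.ball_subset_closedBall)
    ((hφB.add (by fun_prop)).sub (by fun_prop)) ⟨hτ, Metric.mem_closedBall_self hρ.le⟩ hedge
    (Metric.isOpen_ball.prod Metric.isOpen_ball)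
  have hz₀ : g τ₀ + w₀ ∈ s :=
    (htube w₀ (Metric.ball_subset_closedBall hmem.2)).1 τ₀ (Metric.ball_subset_closedBall hmem.1)
  exact not_isLocalMax_penalizedDisc (hφ.submeanAt _ hz₀) (hs.mem_nhds hz₀) hφ.continuousOn hg hη κ
    hmax

end MaximumPrinciple

section ContinuityPrinciple

variable {E : Type*} [NormedAddCommGroup E] [NormedSpace ℂ E] {D D₁ D₂ F U : Set E} {φ : E → ℝ}

/-- The continuity principle (Kontinuitätssatz): a continuous family of analytic discs with
boundaries in `D` stays in `D` if it starts there. Discs are restrictions of entire maps, so that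
no boundary regularity has to be discussed. -/
def ContinuityPrinciple (D : Set E) : Prop :=
  ∀ (g : unitInterval → ℂ → E) (R : ℝ), 0 < R → Continuous (Function.uncurry g) →
    (∀ t, Differentiable ℂ (g t)) → (∀ t, MapsTo (g t) (Metric.sphere 0 R) D) →
    MapsTo (g 0) (Metric.closedBall 0 R) D → ∀ t, MapsTo (g t) (Metric.closedBall 0 R) D

/-- The local form of the continuity principle for `D` at the points of `A`; compare
`IsLocallyPseudoconvexAlong`. -/
def LocalContinuityPrincipleAlong (D A : Set E) : Prop :=
  ∀ ζ ∈ A, ∃ r : ℝ, 0 < r ∧ ContinuityPrinciple (Metric.ball ζ r ∩ D)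

theorem ContinuityPrinciple.inter (h₁ : ContinuityPrinciple D₁) (h₂ : ContinuityPrinciple D₂) :
    ContinuityPrinciple (D₁ ∩ D₂) := fun g R hR hgc hgd hbd h0 t _ hτ =>
  ⟨h₁ g R hR hgc hgd (fun t _ hτ => (hbd t hτ).1) (fun _ hτ => (h0 hτ).1) t hτ,
    h₂ g R hR hgc hgd (fun t _ hτ => (hbd t hτ).2) (fun _ hτ => (h0 hτ).2) t hτ⟩

theorem continuityPrinciple_ball (ζ : E) (r : ℝ) : ContinuityPrinciple (Metric.ball ζ r) := by
  intro g R hR _ hgd hbd _ t τ hτ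
  have hsub : Differentiable ℂ fun σ => g t σ - ζ := (hgd t).sub_const ζ
  obtain ⟨σ, hσ, hmax⟩ := (isCompact_sphere (0 : ℂ) R).exists_isMaxOn
    (NormedSpace.sphere_nonempty.2 hR.le) hsub.continuous.norm.continuousOn
  have hle : ‖g t τ - ζ‖ ≤ ‖g t σ - ζ‖ := by
    refine Complex.norm_le_of_forall_mem_frontier_norm_le (U := Metric.ball (0 : ℂ) R)
      Metric.isBounded_ball hsub.diffContOnCl (fun ξ hξ => ?_) (by rwa [closure_ball _ hR.ne'])
    rw [frontier_ball _ hR.ne'] at hξ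
    exact hmax hξ
  exact mem_ball_iff_norm.2 (hle.trans_lt (mem_ball_iff_norm.1 (hbd t hσ)))

theorem LocalContinuityPrincipleAlong.closure_diff (hD : IsOpen D)
    (h : LocalContinuityPrincipleAlong D (frontier D \ F)) :
    LocalContinuityPrincipleAlong D (closure D \ F) := by
  rintro ζ ⟨hζ, hζF⟩
  by_cases hζD : ζ ∈ D
  · obtain ⟨r, hr, hrD⟩ := Metric.isOpen_iff.1 hD ζ hζD
    exact ⟨r, hr, (inter_eq_left.2 hrD).symm ▸ continuityPrinciple_ball ζ r⟩
  · exact h ζ ⟨hD.frontier_eq ▸ ⟨hζ, hζD⟩, hζF⟩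

theorem LocalContinuityPrincipleAlong.frontier_of_diff
    (hloc : LocalContinuityPrincipleAlong D (frontier D \ F)) (hU : IsOpen U) (hFU : F ⊆ U)
    (hUD : ContinuityPrinciple (U ∩ D)) : LocalContinuityPrincipleAlong D (frontier D) := by
  intro ζ hζ
  by_cases hζF : ζ ∈ F
  · obtain ⟨r, hr, hrU⟩ := Metric.isOpen_iff.1 hU ζ (hFU hζF)
    have hball := (continuityPrinciple_ball ζ r).inter hUD
    rw [← inter_assoc, inter_eq_left.2 hrU] at hball
    exact ⟨r, hr, hball⟩
  · exact hloc ζ ⟨hζ, hζF⟩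

theorem continuityPrinciple_of_sublevel (hφ : ContinuousOn φ D)
    (h : ∀ c : ℝ, ContinuityPrinciple {z ∈ D | φ z < c}) : ContinuityPrinciple D := by
  intro g R hR hgc hgd hbd h0 t τ hτ
  set K := Function.uncurry g '' (univ ×ˢ Metric.sphere 0 R) ∪ g 0 '' Metric.closedBall 0 R
  have hK : IsCompact K := ((isCompact_univ.prod (isCompact_sphere _ _)).image hgc).union
    ((isCompact_closedBall _ _).image (hgd 0).continuous)
  have hKD : K ⊆ D := by
    rintro _ (⟨⟨t, τ⟩, ⟨-, hτ⟩, rfl⟩ | ⟨τ, hτ, rfl⟩)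
    exacts [hbd t hτ, h0 hτ]
  obtain ⟨M, hM⟩ := hK.bddAbove_image (hφ.mono hKD)
  have hK_sub : K ⊆ {z ∈ D | φ z < M + 1} := fun z hz =>
    ⟨hKD hz, (hM (mem_image_of_mem φ hz)).trans_lt (lt_add_one M)⟩
  exact (h (M + 1) g R hR hgc hgd
    (fun t τ hτ => hK_sub (Or.inl ⟨(t, τ), ⟨mem_univ t, hτ⟩, rfl⟩))
    (fun τ hτ => hK_sub (Or.inr ⟨τ, hτ, rfl⟩)) t hτ).1

/-- The discs `σ ↦ g σ + t f(σ) a`, `0 ≤ t ≤ 1`, where `‖a‖ < 1`, have their boundaries in `D`. -/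
theorem ContinuityPrinciple.ball_subset (h : ContinuityPrinciple D) {g : ℂ → E} {f : ℂ → ℂ} {R : ℝ}
    (hR : 0 < R) (hg : Differentiable ℂ g) (hf : Differentiable ℂ f)
    (hgD : MapsTo g (Metric.closedBall 0 R) D)
    (hball : ∀ τ ∈ Metric.sphere 0 R, Metric.ball (g τ) ‖f τ‖ ⊆ D) {τ : ℂ}
    (hτ : τ ∈ Metric.closedBall 0 R) : Metric.ball (g τ) ‖f τ‖ ⊆ D := by
  intro y hy
  rw [mem_ball_iff_norm] at hy
  have hfτ : 0 < ‖f τ‖ := (norm_nonneg _).trans_lt hy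
  set a : E := (f τ)⁻¹ • (y - g τ) with ha
  have ha1 : ‖a‖ < 1 := by
    rwa [ha, norm_smul, norm_inv, inv_mul_lt_iff₀ hfτ, mul_one]
  have hgc := hg.continuous
  have hfc := hf.continuous
  have hdisc := h (fun t σ => g σ + (((t : ℝ) : ℂ) * f σ) • a) R hR
    (by unfold Function.uncurry; fun_prop) (fun t => by fun_prop) (fun t σ hσ => ?_)
    (fun σ hσ => by simpa using hgD hσ) 1 hτ
  · simpa [ha, norm_pos_iff.1 hfτ] using hdisc
  · rcases eq_or_ne (f σ) 0 with hfσ | hfσ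
    · simpa [hfσ] using hgD (Metric.sphere_subset_closedBall hσ)
    · refine hball σ hσ ?_
      rw [mem_ball_iff_norm, add_sub_cancel_left, norm_smul, norm_mul, Complex.norm_real,
        Real.norm_of_nonneg t.2.1]
      calc t * ‖f σ‖ * ‖a‖ ≤ 1 * ‖f σ‖ * ‖a‖ := by gcongr; exact t.2.2
        _ < ‖f σ‖ := by
          rw [one_mul]
          exact mul_lt_of_lt_one_right (norm_pos_iff.2 hfσ) ha1

end ContinuityPrinciple

section PlurisubharmonicExhaustion

/-- `φ` is an exhaustion function of `D`: its sublevel sets are relatively compact in `D`. -/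
def IsExhaustionOn {X : Type*} [TopologicalSpace X] (φ : X → ℝ) (D : Set X) : Prop :=
  ∀ c : ℝ, ∃ K : Set X, IsCompact K ∧ K ⊆ D ∧ {z ∈ D | φ z < c} ⊆ K

variable {E : Type*} [NormedAddCommGroup E] [InnerProductSpace ℂ E] [ProperSpace E] {D : Set E}
  {φ : E → ℝ}

theorem ContinuityPrinciple.sublevel (h : ContinuityPrinciple D) (hD : IsOpen D)
    (hφ : ContinuousPSHOn φ D) (c : ℝ) : ContinuityPrinciple {z ∈ D | φ z < c} := by
  intro g R hR hgc hgd hbd h0 t τ hτ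
  have hgD := h g R hR hgc hgd (fun t _ hτ => (hbd t hτ).1) (fun _ hτ => (h0 hτ).1) t
  obtain ⟨σ, hσ, hmax⟩ := (isCompact_sphere (0 : ℂ) R).exists_isMaxOn
    (NormedSpace.sphere_nonempty.2 hR.le)
    (hφ.continuousOn.comp (hgd t).continuous.continuousOn fun τ hτ => (hbd t hτ).1)
  exact ⟨hgD hτ, (hφ.le_of_forall_sphere_le hD (hgd t) hR hgD (fun τ hτ => hmax hτ) hτ).trans_lt
    (hbd t hσ).2⟩

theorem continuityPrinciple_of_exhaustion (hD : IsOpen D) (hφ : ContinuousPSHOn φ D)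
    (hex : IsExhaustionOn φ D) : ContinuityPrinciple D := by
  intro g R hR hgc hgd hbd h0
  obtain ⟨M, hM⟩ := ((isCompact_univ.prod (isCompact_sphere _ _)).image hgc).bddAbove_image
    (hφ.continuousOn.mono (image_subset_iff.2 fun p hp => hbd p.1 hp.2))
  obtain ⟨K, hK, hKD, hMK⟩ := hex (M + 1)
  set Λ : Set unitInterval := {t | ∀ τ ∈ Metric.closedBall 0 R, g t τ ∈ D}
  have hΛ : Λ = {t | ∀ τ ∈ Metric.closedBall 0 R, g t τ ∈ K} := by
    refine Subset.antisymm (fun t ht τ hτ => hMK ⟨ht τ hτ, ?_⟩) fun t ht τ hτ => hKD (ht τ hτ)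
    refine (hφ.le_of_forall_sphere_le hD (hgd t) hR ht (fun σ hσ => ?_) hτ).trans_lt (lt_add_one M)
    exact hM (mem_image_of_mem φ ⟨(t, σ), ⟨mem_univ t, hσ⟩, rfl⟩)
  have hclosed : IsClosed Λ := by
    rw [hΛ]
    simp only [ofPred_forall]
    exact isClosed_biInter fun τ _ => hK.isClosed.preimage (hgc.comp (Continuous.prodMk_left τ))
  have hopen : IsOpen Λ := isOpen_iff_mem_nhds.2 fun t ht =>
    (isCompact_closedBall (0 : ℂ) R).eventually_forall_of_forall_eventually fun τ hτ =>
      hgc.continuousAt.eventually_mem (hD.mem_nhds (ht τ hτ))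
  have huniv : Λ = univ := IsClopen.eq_univ ⟨hclosed, hopen⟩ ⟨0, h0⟩
  exact fun t => huniv.ge (mem_univ t)

end PlurisubharmonicExhaustion

section BoundaryDistance

section MetricSpace

variable {X : Type*} [PseudoMetricSpace X] {D : Set X} {z ζ : X}

/-- The function `-log δ_D`, where `δ_D` is the distance to the complement of `D`; it is the junk
value `0` if `D` is the whole space. -/
noncomputable def negLogBoundaryDist (D : Set X) (z : X) : ℝ :=
  -Real.log (Metric.infDist z Dᶜ)

theorem infDist_compl_pos (hD : IsOpen D) (hne : Dᶜ.Nonempty) (hz : z ∈ D) :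
    0 < Metric.infDist z Dᶜ :=
  (hD.isClosed_compl.notMem_iff_infDist_pos hne).1 (notMem_compl_iff.2 hz)

theorem le_infDist_compl_iff (hne : Dᶜ.Nonempty) {r : ℝ} :
    r ≤ Metric.infDist z Dᶜ ↔ Metric.ball z r ⊆ D := by
  rw [Metric.le_infDist hne, ← compl_subset_compl]
  simp only [subset_def, mem_compl_iff, Metric.mem_ball, not_lt, dist_comm z]

theorem negLogBoundaryDist_le_iff (hD : IsOpen D) (hne : Dᶜ.Nonempty) (hz : z ∈ D) {a : ℝ} :
    negLogBoundaryDist D z ≤ a ↔ Real.exp (-a) ≤ Metric.infDist z Dᶜ := by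
  rw [negLogBoundaryDist, neg_le, Real.le_log_iff_exp_le (infDist_compl_pos hD hne hz)]

theorem continuousOn_negLogBoundaryDist (hD : IsOpen D) (hne : Dᶜ.Nonempty) :
    ContinuousOn (negLogBoundaryDist D) D :=
  (ContinuousOn.log (Metric.continuous_infDist_pt _).continuousOn fun _ hz =>
    (infDist_compl_pos hD hne hz).ne').neg

theorem isExhaustionOn_negLogBoundaryDist [ProperSpace X] (hD : IsOpen D)
    (hb : Bornology.IsBounded D) (hne : Dᶜ.Nonempty) :
    IsExhaustionOn (negLogBoundaryDist D) D := by
  intro c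
  have hKD : {z | Real.exp (-c) ≤ Metric.infDist z Dᶜ} ⊆ D := fun z hz =>
    (le_infDist_compl_iff hne).1 hz (Metric.mem_ball_self (Real.exp_pos _))
  refine ⟨_, Metric.isCompact_of_isClosed_isBounded
    (isClosed_le continuous_const (Metric.continuous_infDist_pt _)) (hb.subset hKD), hKD, ?_⟩
  exact fun z hz => (negLogBoundaryDist_le_iff hD hne hz.1).1 hz.2.le

theorem negLogBoundaryDist_ball_inter {r : ℝ} (hζ : ζ ∉ D) (hz : z ∈ Metric.ball ζ (r / 2)) :
    negLogBoundaryDist (Metric.ball ζ r ∩ D) z = negLogBoundaryDist D z := by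
  have hne : Dᶜ.Nonempty := ⟨ζ, hζ⟩
  have hne' : (Metric.ball ζ r ∩ D)ᶜ.Nonempty := ⟨ζ, fun h => hζ h.2⟩
  have hdist : Metric.infDist z (Metric.ball ζ r ∩ D)ᶜ = Metric.infDist z Dᶜ := by
    refine eq_of_forall_le_iff fun ρ => ?_
    rw [le_infDist_compl_iff hne', le_infDist_compl_iff hne, subset_inter_iff,
      and_iff_right_iff_imp]
    intro hρ
    have hρζ : ρ ≤ dist ζ z := not_lt.1 fun hlt => hζ (hρ hlt)
    rw [dist_comm] at hρζ
    exact Metric.ball_subset_ball' (by linarith [Metric.mem_ball.1 hz])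
  rw [negLogBoundaryDist, negLogBoundaryDist, hdist]

end MetricSpace

variable {E : Type*} [NormedAddCommGroup E] [NormedSpace ℂ E] {D : Set E} {z ζ : E}

theorem ContinuityPrinciple.submeanAt_negLogBoundaryDist (h : ContinuityPrinciple D) (hD : IsOpen D)
    (hne : Dᶜ.Nonempty) (hz : z ∈ D) : SubmeanAt (negLogBoundaryDist D) z := by
  have hle_iff : ∀ {w : E} {f : ℂ}, w ∈ D →
      (negLogBoundaryDist D w ≤ f.re ↔ Metric.ball w ‖Complex.exp (-f)‖ ⊆ D) := fun hw => by
    rw [negLogBoundaryDist_le_iff hD hne hw, le_infDist_compl_iff hne, Complex.norm_exp,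
      Complex.neg_re]
  intro b
  filter_upwards [eventually_mapsTo_line (hD.mem_nhds hz) b, self_mem_nhdsWithin] with r hmaps hr
  have hsphere := hmaps.mono_left Metric.sphere_subset_closedBall
  refine le_circleAverage_of_forall_entire hr
    ((continuousOn_negLogBoundaryDist hD hne).comp (by fun_prop) hsphere) fun f hf hfu => ?_
  have hball := h.ball_subset (f := fun τ => Complex.exp (-f τ)) hr (by fun_prop) (by fun_prop)
    hmaps (fun τ hτ => (hle_iff (hsphere hτ)).1 (hfu τ hτ).le)
    (Metric.mem_closedBall_self (le_of_lt hr))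
  rw [zero_smul, add_zero] at hball
  exact (hle_iff hz).2 hball

theorem LocalContinuityPrincipleAlong.eventually_submeanAt
    (hloc : LocalContinuityPrincipleAlong D (frontier D)) (hD : IsOpen D) (hζ : ζ ∈ frontier D) :
    ∀ᶠ z in 𝓝[D] ζ, SubmeanAt (negLogBoundaryDist D) z := by
  obtain ⟨r, hr, hcp⟩ := hloc ζ hζ
  have hζD : ζ ∉ D := (hD.frontier_eq ▸ hζ).2
  have hne : (Metric.ball ζ r ∩ D)ᶜ.Nonempty := ⟨ζ, fun h => hζD h.2⟩
  set B := Metric.ball ζ (r / 2) ∩ D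
  have hB : IsOpen B := Metric.isOpen_ball.inter hD
  have hBr : B ⊆ Metric.ball ζ r ∩ D :=
    inter_subset_inter_left _ (Metric.ball_subset_ball (half_le_self hr.le))
  have hO : IsOpen (Metric.ball ζ r ∩ D) := Metric.isOpen_ball.inter hD
  filter_upwards [mem_nhdsWithin_of_mem_nhds (Metric.ball_mem_nhds ζ (half_pos hr)),
    self_mem_nhdsWithin] with z hzζ hzD
  have hloc_eq : ∀ w ∈ B, negLogBoundaryDist (Metric.ball ζ r ∩ D) w = negLogBoundaryDist D w :=
    fun w hw => negLogBoundaryDist_ball_inter hζD hw.1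
  exact (hcp.submeanAt_negLogBoundaryDist hO hne (hBr ⟨hzζ, hzD⟩)).of_le (hB.mem_nhds ⟨hzζ, hzD⟩)
    ((continuousOn_negLogBoundaryDist hO hne).mono hBr)
    ((continuousOn_negLogBoundaryDist hD ⟨ζ, hζD⟩).mono inter_subset_right)
    (fun w hw => (hloc_eq w hw).le) (hloc_eq z ⟨hzζ, hzD⟩).ge

theorem LocalContinuityPrincipleAlong.exists_exhaustion [ProperSpace E]
    (hloc : LocalContinuityPrincipleAlong D (frontier D)) (hD : IsOpen D)
    (hb : Bornology.IsBounded D) : ∃ φ : E → ℝ, ContinuousPSHOn φ D ∧ IsExhaustionOn φ D := by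
  rcases Dᶜ.eq_empty_or_nonempty with hempty | hne
  · obtain rfl : D = univ := compl_empty_iff.1 hempty
    exact ⟨fun _ => 0, ⟨continuousOn_const, fun z _ => submeanAt_const 0 z⟩, fun _ =>
      ⟨univ, by simpa using hb.isCompact_closure, Subset.rfl, subset_univ _⟩⟩
  · obtain ⟨C, hC⟩ := exists_continuousPSHOn_max_const hD hb
      (continuousOn_negLogBoundaryDist hD hne) fun ζ hζ => hloc.eventually_submeanAt hD hζ
    refine ⟨_, hC, fun c => ?_⟩
    obtain ⟨K, hK, hKD, hcK⟩ := isExhaustionOn_negLogBoundaryDist hD hb hne c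
    exact ⟨K, hK, hKD, fun z hz => hcK ⟨hz.1, (le_max_left _ _).trans_lt hz.2⟩⟩

end BoundaryDistance

section LocalToGlobal

variable {E : Type*} [NormedAddCommGroup E] [InnerProductSpace ℂ E] [ProperSpace E]
  {Ω F U : Set E} {w : E → ℝ}

theorem LocalContinuityPrincipleAlong.continuityPrinciple {D : Set E}
    (hloc : LocalContinuityPrincipleAlong D (frontier D)) (hD : IsOpen D)
    (hb : Bornology.IsBounded D) : ContinuityPrinciple D := by
  obtain ⟨φ, hφ, hex⟩ := hloc.exists_exhaustion hD hb
  exact continuityPrinciple_of_exhaustion hD hφ hex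

theorem notMem_closure_sublevel {X : Type*} [TopologicalSpace X] {s : Set X} {f : X → ℝ} {x : X}
    (h : Tendsto f (𝓝[s] x) atTop) (c : ℝ) : x ∉ closure {y ∈ s | f y < c} := by
  intro hx
  have hfreq : ∃ᶠ y in 𝓝 x, y ∈ s ∧ f y < c := mem_closure_iff_frequently.1 hx
  have hev : ∀ᶠ y in 𝓝 x, y ∈ s → c ≤ f y :=
    eventually_nhdsWithin_iff.1 (h.eventually_ge_atTop c)
  obtain ⟨y, ⟨hys, hlt⟩, hge⟩ := (hfreq.and_eventually hev).exists
  exact (hge hys).not_gt hlt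

theorem ContinuityPrinciple.inter_of_tendsto_atTop (hU : ContinuityPrinciple U) (hUo : IsOpen U)
    (hΩo : IsOpen Ω) (hΩb : Bornology.IsBounded Ω)
    (hloc : LocalContinuityPrincipleAlong Ω (frontier Ω \ F)) (hw : ContinuousPSHOn w (U ∩ Ω))
    (hF : ∀ ζ ∈ F, Tendsto w (𝓝[U ∩ Ω] ζ) atTop) : ContinuityPrinciple (U ∩ Ω) := by
  refine continuityPrinciple_of_sublevel hw.continuousOn fun c => ?_
  set D := {z ∈ U ∩ Ω | w z < c}
  have hD : IsOpen D := hw.continuousOn.isOpen_inter_preimage (hUo.inter hΩo) isOpen_Iio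
  have hDΩ : D ⊆ Ω := fun z hz => hz.1.2
  refine LocalContinuityPrincipleAlong.continuityPrinciple (fun ζ hζ => ?_) hD (hΩb.subset hDΩ)
  have hζD : ζ ∈ closure D := frontier_subset_closure hζ
  have hζF : ζ ∉ F := fun hζF => notMem_closure_sublevel (hF ζ hζF) c hζD
  obtain ⟨r, hr, hball⟩ := hloc.closure_diff hΩo ζ ⟨closure_mono hDΩ hζD, hζF⟩
  have hsub : U ∩ (Metric.ball ζ r ∩ Ω) ⊆ U ∩ Ω := inter_subset_inter_right _ inter_subset_right
  have hsublevel : Metric.ball ζ r ∩ D = {z ∈ U ∩ (Metric.ball ζ r ∩ Ω) | w z < c} := by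
    ext z
    simp only [D, mem_inter_iff, mem_ofPred_eq]
    tauto
  refine ⟨r, hr, hsublevel ▸ (hU.inter hball).sublevel ?_ (hw.mono hsub) c⟩
  exact hUo.inter (Metric.isOpen_ball.inter hΩo)

end LocalToGlobal

section Pseudoconvex

theorem coe_toReal_max {x : EReal} (hx : x < ⊤) (C : ℝ) :
    ((max x C).toReal : EReal) = max x C :=
  EReal.coe_toReal (max_lt hx (EReal.coe_lt_top C)).ne
    ((EReal.bot_lt_coe C).trans_le (le_max_right x C)).ne'

theorem tendsto_toReal_max_atTop {α : Type*} {l : Filter α} {v : α → EReal}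
    (hv : ∀ᶠ x in l, v x < ⊤) (h : Tendsto v l (𝓝 ⊤)) (C : ℝ) :
    Tendsto (fun x => (max (v x) C).toReal) l atTop := by
  rw [← EReal.tendsto_coe_nhds_top_iff]
  have hmax : Tendsto (fun x => max (v x) C) l (𝓝 ⊤) := by
    simpa using h.max (tendsto_const_nhds (x := (C : EReal)))
  exact hmax.congr' (hv.mono fun x hx => (coe_toReal_max hx C).symm)

variable {n : ℕ} {D s : Set (EuclideanSpace ℂ (Fin n))} {φ : EuclideanSpace ℂ (Fin n) → ℝ}

theorem PlurisubharmonicOn.continuousPSHOn_toReal_max {v : EuclideanSpace ℂ (Fin n) → EReal}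
    (hv : PlurisubharmonicOn v s) (hs : IsOpen s) (hvc : ContinuousOn v s) (C : ℝ) :
    ContinuousPSHOn (fun z => (max (v z) C).toReal) s := by
  have hcoe : ∀ z ∈ s, ((max (v z) C).toReal : EReal) = max (v z) C := fun z hz =>
    coe_toReal_max (hv.lt_top z hz) C
  have hcont : ContinuousOn (fun z => (max (v z) C).toReal) s :=
    EReal.continuousOn_toReal.comp (hvc.sup continuousOn_const) fun z hz => by
      rw [← hcoe z hz]
      simp
  refine ⟨hcont, fun z hz => ?_⟩
  rcases le_total (C : EReal) (v z) with hC | hC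
  · intro b
    filter_upwards [(hv.subharmonicOn_line z b).submean 0 (by simpa using hz)] with r hmean
    rw [← EReal.coe_le_coe_iff, hcoe z hz, max_eq_left hC]
    simpa using hmean C
  · refine (submeanAt_const C z).of_le (hs.mem_nhds hz) continuousOn_const hcont
      (fun w hw => ?_) (by simp [hC])
    rw [← EReal.coe_le_coe_iff, hcoe w hw]
    exact le_max_right _ _

theorem PlurisubharmonicOn.continuousPSHOn (hφ : PlurisubharmonicOn (fun z => (φ z : EReal)) s)
    (hs : IsOpen s) (hφc : ContinuousOn φ s) : ContinuousPSHOn φ s := by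
  refine ⟨hφc, fun z hz => ?_⟩
  have htrunc := hφ.continuousPSHOn_toReal_max hs
    (continuous_coe_real_ereal.comp_continuousOn hφc) (φ z - 1)
  simp only [← EReal.coe_strictMono.monotone.map_max, EReal.toReal_coe] at htrunc
  have hnear : {w ∈ s | φ z - 1 < φ w} ∈ 𝓝 z :=
    (hφc.isOpen_inter_preimage hs isOpen_Ioi).mem_nhds ⟨hz, sub_one_lt (φ z)⟩
  exact (htrunc.submeanAt z hz).of_le hnear (htrunc.continuousOn.mono (sep_subset _ _))
    (hφc.mono (sep_subset _ _)) (fun w hw => max_le le_rfl hw.2.le) (le_max_left _ _)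

theorem ContinuousPSHOn.plurisubharmonicOn (hφ : ContinuousPSHOn φ s) (hs : IsOpen s) :
    PlurisubharmonicOn (fun z => (φ z : EReal)) s := by
  have hcoe : ContinuousOn (fun z => (φ z : EReal)) s :=
    continuous_coe_real_ereal.comp_continuousOn hφ.continuousOn
  refine ⟨fun _ _ => EReal.coe_lt_top _, hcoe.upperSemicontinuousOn, fun a b =>
    ⟨fun _ _ => EReal.coe_lt_top _, ?_, fun c hc => ?_⟩⟩
  · exact (hcoe.comp (f := fun τ : ℂ => a + τ • b) (by fun_prop)
      fun _ hτ => hτ).upperSemicontinuousOn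
  filter_upwards [hφ.submeanAt _ hc b, self_mem_nhdsWithin,
    eventually_continuousOn_sphere_line (hs.mem_nhds hc) hφ.continuousOn b] with r hmean hr hφr M
  have hr : 0 < r := hr
  have hline : ∀ τ : ℂ, a + (τ + c) • b = a + c • b + τ • b := fun τ => by
    rw [add_smul]
    abel
  rw [← Real.circleAverage_map_add_const, EReal.coe_le_coe_iff]
  simp only [← EReal.coe_strictMono.monotone.map_max, EReal.toReal_coe, hline]
  exact hmean.trans (Real.circleAverage_mono (hφr.circleIntegrable hr.le)
    ((hφr.sup continuousOn_const).circleIntegrable hr.le) fun _ _ => le_max_left _ _)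

theorem IsPseudoconvex.continuityPrinciple (h : IsPseudoconvex D) : ContinuityPrinciple D := by
  obtain ⟨hD, φ, hφc, hφ, hex⟩ := h
  exact continuityPrinciple_of_exhaustion hD (hφ.continuousPSHOn hD hφc) hex

theorem IsLocallyPseudoconvexAlong.localContinuityPrincipleAlong
    {A : Set (EuclideanSpace ℂ (Fin n))} (h : IsLocallyPseudoconvexAlong D A) :
    LocalContinuityPrincipleAlong D A := fun ζ hζ =>
  let ⟨r, hr, hpc⟩ := h ζ hζ
  ⟨r, hr, hpc.continuityPrinciple⟩

theorem LocalContinuityPrincipleAlong.isPseudoconvex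
    (hloc : LocalContinuityPrincipleAlong D (frontier D)) (hD : IsOpen D)
    (hb : Bornology.IsBounded D) : IsPseudoconvex D := by
  obtain ⟨φ, hφ, hex⟩ := hloc.exists_exhaustion hD hb
  exact ⟨hD, φ, hφ.continuousOn, hφ.plurisubharmonicOn hD, hex⟩

end Pseudoconvex

theorem proposition2p3_general {n : ℕ} {Ω F U : Set (EuclideanSpace ℂ (Fin n))}
    {v : EuclideanSpace ℂ (Fin n) → EReal} (hΩo : IsOpen Ω) (hΩb : Bornology.IsBounded Ω)
    (hloc : IsLocallyPseudoconvexAlong Ω (frontier Ω \ F)) (hU : IsPseudoconvex U) (hFU : F ⊆ U)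
    (hvc : ContinuousOn v (U ∩ Ω)) (hv : PlurisubharmonicOn v (U ∩ Ω))
    (hFv : ∀ ζ ∈ F, Tendsto v (𝓝[U ∩ Ω] ζ) (𝓝 ⊤)) : IsPseudoconvex Ω := by
  have hlocCP : LocalContinuityPrincipleAlong Ω (frontier Ω \ F) :=
    hloc.localContinuityPrincipleAlong
  have hw : ContinuousPSHOn (fun z => (max (v z) (0 : ℝ)).toReal) (U ∩ Ω) :=
    hv.continuousPSHOn_toReal_max (hU.1.inter hΩo) hvc 0
  have hwF : ∀ ζ ∈ F, Tendsto (fun z => (max (v z) (0 : ℝ)).toReal) (𝓝[U ∩ Ω] ζ) atTop :=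
    fun ζ hζ => tendsto_toReal_max_atTop (eventually_mem_nhdsWithin.mono hv.lt_top) (hFv ζ hζ) 0
  have hUΩ : ContinuityPrinciple (U ∩ Ω) :=
    hU.continuityPrinciple.inter_of_tendsto_atTop hU.1 hΩo hΩb hlocCP hw hwF
  exact (hlocCP.frontier_of_diff hU.1 hFU hUΩ).isPseudoconvex hΩo hΩb

theorem proposition2p3 (n : ℕ) (Ω F U : Set (EuclideanSpace ℂ (Fin n)))
    (v : EuclideanSpace ℂ (Fin n) → EReal)
    (hΩo : IsOpen Ω) (hΩc : IsConnected Ω) (hΩb : Bornology.IsBounded Ω)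
    (hFne : F.Nonempty) (hFc : IsClosed F) (hF : F ⊆ frontier Ω)
    (hloc : IsLocallyPseudoconvexAlong Ω (frontier Ω \ F))
    (hU : IsPseudoconvex U) (hFU : F ⊆ U)
    (hvc : ContinuousOn v (U ∩ Ω)) (hv : PlurisubharmonicOn v (U ∩ Ω))
    (hFv : F = {z ∈ frontier Ω | z ∈ closure (U ∩ Ω) ∧ Tendsto v (𝓝[U ∩ Ω] z) (𝓝 ⊤)}) :
    IsPseudoconvex Ω :=
  proposition2p3_general hΩo hΩb hloc hU hFU hvc hv fun _ hζ => (hFv.subset hζ).2.2
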